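/- **Definitions.** For $F:\{0,1\}^n\times\{0,1\}^k\to\{0,1\}$ let $\mathrm{Size}(F)$ be the least number of gates of a Boolean circuit over the set of all 2-input Boolean gates that computes $F(x,y)$ from the $n+k$ input bits of $x$ and $y$. For a two-party function $H:\mathcal A\times\mathcal B\to\{0,1\}$ on finite sets, $\mathrm{arank}(H)$ is the minimum rank of a real $\mathcal A\times\mathcal B$ matrix $A$ with $|A(a,b)-H(a,b)|\le 1/3$ for all $a,b$. Put $\mathcal X=\{0,1\}^n$, $\mathcal Y=\{0,1\}^k$, let $c>0$ be an integer and let $F^c(\mathbf x,\mathbf y)=(F(x_1,y_1),\dots,F(x_c,y_c))\in\{0,1\}^c$ for $\mathbf x\in\mathcal X^c$, $\mathbf y\in\mathcal Y^c$. Consider a family $\mathcal G=\{G_0,\dots,G_{2^c-1}\}$ of functions $G_i:(\mathcal X^c\times\{0,1\}^m)\times(\mathcal Y^c\times\{0,1\}^m)\to\{0,1\}$, the indices $i$ being identified with strings in $\{0,1\}^c$. The lookup function $F_{\mathcal G}$ has as inputs $(\mathbf x,(u_i)_i)$ for Alice and $(\mathbf y,(v_i)_i)$ for Bob, with one cell $u_i,v_i\in\{0,1\}^m$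 for each $i\in\{0,1\}^c$, and its value is $G_\ell(\mathbf x,u_\ell,\mathbf y,v_\ell)$ where $\ell=F^c(\mathbf x,\mathbf y)$. * $\mathcal G$ is a *nontrivial XOR family* (for $F$) if (1) for all $\mathbf x,\mathbf y$, with $\ell=F^c(\mathbf x,\mathbf y)$, there are $u,v,u',v'$ with $G_\ell(\mathbf x,u,\mathbf y,v)\ne G_\ell(\mathbf x,u',\mathbf y,v')$; and (2) for all $i,\mathbf x,\mathbf y$, $u\oplus v=u'\oplus v'$ implies $G_i(\mathbf x,u,\mathbf y,v)=G_i(\mathbf x,u',\mathbf y,v')$. * $F_{\mathcal G}$ is *unambiguous* if $G_i(\mathbf x,u,\mathbf y,v)=1$ implies $F^c(\mathbf x,\mathbf y)=i$. * $\mathcal G$ *checks circuit-evaluation certificates* if there are a circuit $C$ for $F$ with exactly $\mathrm{Size}(F)$ gates, and a bijective labelling of the $m$ bits of a cell as the claimed values of the two inputs and the output of each gate of $C$ in each of the $c$ instances (so $m=3c\,\mathrm{Size}(F)$), such that $G_i(\mathbf x,u,\mathbf y,v)=1$ if and only if in the string $u\oplus v$, for every instance $j$, all claimed gate inputs agree with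 the bits of $(x_j,y_j)$ and with the claimed outputs of earlier gates to which they are wired, every gate is evaluated correctly, and the output of the circuit is $i_j$. **Theorem.** There are absolute constants $K$ and $d$ such that the following holds. Let $F:\{0,1\}^n\times\{0,1\}^k\to\{0,1\}$ be a total function with $\mathrm{Size}(F)\ge 1$, and let $c>0$ be an integer. Then there are $m$ and a nontrivial XOR family $\mathcal G=\{G_0,\dots,G_{2^c-1}\}$ that checks circuit-evaluation certificates, such that $F_{\mathcal G}$ is unambiguous and $$\log_2\mathrm{arank}(F_{\mathcal G})\;\le\;K\,s\,\bigl(\log_2(2+s)\bigr)^d,\qquad s=c^{3/2}\sqrt{\mathrm{Size}(F)},$$ that is, $\log\mathrm{arank}(F_{\mathcal G})=\widetilde O\bigl(c^{3/2}\sqrt{\mathrm{Size}(F)}\bigr)$. -/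

import Mathlib

/-- Bit strings `{0,1}ⁿ`. -/
abbrev BitString (n : ℕ) : Type := Fin n → Bool

/-! ### Boolean circuits and circuit size -/

/-- A wire carrying one of Alice's `n` input bits, one of Bob's `k` input bits, or the value of
one of the first `t` gates. -/
inductive Wire (n k t : ℕ) : Type
  | alice (a : Fin n) : Wire n k t
  | bob (b : Fin k) : Wire n k t
  | gate (h : Fin t) : Wire n k t

/-- The bit carried by a wire, given the inputs and the (true or claimed) values of the gates. -/
def Wire.value {n k t : ℕ} (x : BitString n) (y : BitString k) (val : Fin t → Bool) :
    Wire n k t → Bool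
  | .alice a => x a
  | .bob b => y b
  | .gate h => val h

/-- A Boolean circuit on `n + k` input bits over the gate set of all 2-input Boolean gates. The
gates are listed in a topological order: the two input wires of gate number `g` carry input bits
or values of gates with smaller numbers. Fan-out is unbounded. -/
structure Circuit (n k : ℕ) : Type where
  /-- the number of gates -/
  size : ℕ
  /-- the Boolean operation of each gate -/
  op : Fin size → Bool → Bool → Bool
  /-- the first input wire of each gate -/
  left : (g : Fin size) → Wire n k g.val
  /-- the second input wire of each gate -/
  right : (g : Fin size) → Wire n k g.val
  /-- the output wire of the circuit -/
  out : Wire n k size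

/-- The value of gate `g` of `C` on the input `(x, y)`. -/
def Circuit.gateValue {n k : ℕ} (C : Circuit n k) (x : BitString n) (y : BitString k)
    (g : Fin C.size) : Bool :=
  C.op g
    ((C.left g).value x y fun h => C.gateValue x y ⟨h.val, h.isLt.trans g.isLt⟩)
    ((C.right g).value x y fun h => C.gateValue x y ⟨h.val, h.isLt.trans g.isLt⟩)
termination_by g.val
decreasing_by all_goals exact h.isLt

/-- The output of `C` on the input `(x, y)`. -/
def Circuit.eval {n k : ℕ} (C : Circuit n k) (x : BitString n) (y : BitString k) : Bool :=
  C.out.value x y (C.gateValue x y)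

/-- `C` computes `F`. -/
def Circuit.Computes {n k : ℕ} (C : Circuit n k) (F : BitString n → BitString k → Bool) : Prop :=
  ∀ x y, C.eval x y = F x y

/-- `Size(F)`: the least number of gates of a circuit that computes `F`. -/
noncomputable def circuitSize {n k : ℕ} (F : BitString n → BitString k → Bool) : ℕ :=
  sInf {s : ℕ | ∃ C : Circuit n k, C.Computes F ∧ C.size = s}

/-! ### Approximate rank -/

/-- The communication matrix of a two-party Boolean function, with entries `0` and `1`. -/
def commMatrix {X Y : Type*} (F : X → Y → Bool) : Matrix X Y ℝ :=
  Matrix.of fun x y => if F x y then 1 else 0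

/-- `rank_ε(M)`: the least rank of a real matrix that is entrywise `ε`-close to `M`. -/
noncomputable def approxRank {X Y : Type*} [Fintype Y] (ε : ℝ) (M : Matrix X Y ℝ) : ℕ :=
  sInf {r : ℕ | ∃ A : Matrix X Y ℝ, (∀ x y, |A x y - M x y| ≤ ε) ∧ A.rank = r}

/-- The approximate rank of a two-party function, with entrywise error `1/3`. -/
noncomputable def arank {X Y : Type*} [Fintype Y] (F : X → Y → Bool) : ℕ :=
  approxRank (1 / 3) (commMatrix F)

/-! ### Lookup functions -/

/-- A family `(G_i)`, indexed by `i ∈ {0,1}^c` (equivalently by `0, …, 2^c - 1`), of functions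
`G_i : (X^c × {0,1}^m) × (Y^c × {0,1}^m) → {0,1}`, written `G i x u y v`. -/
abbrev CellFamily (X Y : Type*) (c m : ℕ) : Type _ :=
  BitString c → (Fin c → X) → BitString m → (Fin c → Y) → BitString m → Bool

/-- `F^c`: the answers to `c` independent instances of `F`. -/
def powFun {X Y : Type*} (F : X → Y → Bool) {c : ℕ} (x : Fin c → X) (y : Fin c → Y) :
    BitString c :=
  fun j => F (x j) (y j)

/-- The `(F, G)`-lookup function. Alice holds `x ∈ X^c` and an array `u` of `2^c` cells, Bob holds
`y ∈ Y^c` and an array `v` of `2^c` cells, and the value is `G_ℓ(x, u_ℓ, y, v_ℓ)` at the address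
`ℓ = F^c(x, y)`. -/
def lookup {X Y : Type*} (F : X → Y → Bool) {c m : ℕ} (G : CellFamily X Y c m)
    (p : (Fin c → X) × (BitString c → BitString m))
    (q : (Fin c → Y) × (BitString c → BitString m)) : Bool :=
  G (powFun F p.1 q.1) p.1 (p.2 (powFun F p.1 q.1)) q.1 (q.2 (powFun F p.1 q.1))

/-- Bitwise exclusive or. -/
def bitXor {m : ℕ} (u v : BitString m) : BitString m := fun t => xor (u t) (v t)

/-- `G` is a nontrivial XOR family for `F`. -/
structure IsNontrivialXORFamily {X Y : Type*} (F : X → Y → Bool) {c m : ℕ}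
    (G : CellFamily X Y c m) : Prop where
  nontrivial : ∀ (x : Fin c → X) (y : Fin c → Y), ∃ u v u' v' : BitString m,
    G (powFun F x y) x u y v ≠ G (powFun F x y) x u' y v'
  xor_function : ∀ (i : BitString c) (u u' v v' : BitString m) (x : Fin c → X) (y : Fin c → Y),
    bitXor u v = bitXor u' v' → G i x u y v = G i x u' y v'

/-- The lookup function of `F` and `G` is unambiguous: `G_i = 1` certifies `F^c(x, y) = i`. -/
def IsUnambiguous {X Y : Type*} (F : X → Y → Bool) {c m : ℕ} (G : CellFamily X Y c m) : Prop :=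
  ∀ (i : BitString c) (x : Fin c → X) (u : BitString m) (y : Fin c → Y) (v : BitString m),
    G i x u y v = true → powFun F x y = i

/-! ### Circuit-evaluation certificates -/

/-- The claimed evaluations of a circuit on `c` instances: for each instance and each of the `s`
gates, the claimed values of the gate's first input (position `0`), second input (position `1`)
and output (position `2`). -/
abbrev Transcript (c s : ℕ) : Type := Fin c × Fin s × Fin 3 → Bool

/-- `w` is a correct certificate, by evaluations of `C`, that the `c` instances `(x_j, y_j)` have
the answers `i_j`: the claimed inputs of each gate agree with the players' input bits and with the
claimed outputs of the earlier gates, each gate is evaluated correctly, and the output of the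
circuit on the `j`-th instance is `i_j`. -/
structure Circuit.IsCertificate {n k : ℕ} (C : Circuit n k) {c : ℕ}
    (x : Fin c → BitString n) (y : Fin c → BitString k) (i : BitString c)
    (w : Transcript c C.size) : Prop where
  left_input : ∀ (j : Fin c) (g : Fin C.size), w (j, g, 0) =
    (C.left g).value (x j) (y j) fun h => w (j, ⟨h.val, h.isLt.trans g.isLt⟩, 2)
  right_input : ∀ (j : Fin c) (g : Fin C.size), w (j, g, 1) =
    (C.right g).value (x j) (y j) fun h => w (j, ⟨h.val, h.isLt.trans g.isLt⟩, 2)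
  gate_output : ∀ (j : Fin c) (g : Fin C.size), w (j, g, 2) = C.op g (w (j, g, 0)) (w (j, g, 1))
  final_output : ∀ j : Fin c, C.out.value (x j) (y j) (fun h => w (j, h, 2)) = i j

/-- Each `G_i` checks a circuit-evaluation certificate: for some smallest circuit `C` for `F` and
some layout `e` of the positions of a transcript of `C` as the positions of a cell, `G_i` is `1`
exactly when `u ⊕ v` is a correct certificate that the instances have the answers `i`. -/
def ChecksCertificates {n k : ℕ} (F : BitString n → BitString k → Bool) {c m : ℕ}
    (G : CellFamily (BitString n) (BitString k) c m) : Prop :=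
  ∃ C : Circuit n k, C.Computes F ∧ C.size = circuitSize F ∧
    ∃ e : Fin c × Fin C.size × Fin 3 ≃ Fin m,
      ∀ (i : BitString c) (x : Fin c → BitString n) (u : BitString m)
        (y : Fin c → BitString k) (v : BitString m),
        G i x u y v = true ↔ C.IsCertificate x y i fun p => bitXor u v (e p)

/-! Take a minimal circuit with S gates and let each cell be the conjunction of N = 3cS + c local
checks on u ⊕ v. Each check sees Alice's side through at most three bits, so its violation matrix
has rank at most 8, and the number W of violated checks has rank at most 8N. With d ≈ √N, an affine
substitution followed by the Chebyshev polynomial T_d, normalized, turns W into a matrix of rank at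
most (8N+2)^d that is exactly 1 when W = 0 and at most 1/2 in absolute value otherwise
(`exists_factorRankLE_approx_forall`). Its power c + 2 has error 2^-(c+2). A certificate determines
all answers, so at most one of the 2^c cells is 1 and the lookup function is simply their sum
(`arank_lookup_le`): the address is never computed, and the total error is 1/4. The log-rank is at
most c + (c+2)·d·log(8N+2), which is about c·√(cS) up to a logarithm. -/

/-! ### Factorization rank -/

/-- The real matrix `M` is a sum of at most `r` products of a function of the row and a function
of the column. -/
def FactorRankLE {A B : Type*} (M : A → B → ℝ) (r : ℕ) : Prop :=
  ∃ (ι : Type) (_ : Fintype ι), Fintype.card ι ≤ r ∧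
    ∃ (U : A → ι → ℝ) (V : ι → B → ℝ), ∀ a b, M a b = ∑ i, U a i * V i b

namespace FactorRankLE

variable {A B : Type*} {M M' : A → B → ℝ} {r r' : ℕ}

theorem mono (h : FactorRankLE M r) (hr : r ≤ r') : FactorRankLE M r' := by
  obtain ⟨ι, hι, hc, U, V, hM⟩ := h
  exact ⟨ι, hι, hc.trans hr, U, V, hM⟩

theorem rank_le [Fintype B] (h : FactorRankLE M r) : (Matrix.of M).rank ≤ r := by
  obtain ⟨ι, hι, hc, U, V, hM⟩ := h
  have hmul : Matrix.of M = Matrix.of U * Matrix.of V := by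
    ext a b
    simp [Matrix.mul_apply, hM]
  rw [hmul]
  exact (Matrix.rank_mul_le_left _ _).trans ((Matrix.rank_le_card_width _).trans hc)

theorem add (h : FactorRankLE M r) (h' : FactorRankLE M' r') :
    FactorRankLE (fun a b => M a b + M' a b) (r + r') := by
  obtain ⟨ι, hι, hc, U, V, hM⟩ := h
  obtain ⟨ι', hι', hc', U', V', hM'⟩ := h'
  refine ⟨ι ⊕ ι', inferInstance, ?_, fun a => Sum.elim (U a) (U' a), Sum.elim V V', ?_⟩
  · simpa using Nat.add_le_add hc hc'
  · intro a b
    simp [Fintype.sum_sum_type, hM, hM']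

theorem mul (h : FactorRankLE M r) (h' : FactorRankLE M' r') :
    FactorRankLE (fun a b => M a b * M' a b) (r * r') := by
  obtain ⟨ι, hι, hc, U, V, hM⟩ := h
  obtain ⟨ι', hι', hc', U', V', hM'⟩ := h'
  refine ⟨ι × ι', inferInstance, ?_, fun a p => U a p.1 * U' a p.2,
    fun p b => V p.1 b * V' p.2 b, ?_⟩
  · simpa using Nat.mul_le_mul hc hc'
  · intro a b
    simp only [hM, hM', Finset.sum_mul_sum, Fintype.sum_prod_type]
    exact Finset.sum_congr rfl fun i _ => Finset.sum_congr rfl fun j _ => by ring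

theorem const (x : ℝ) : FactorRankLE (fun (_ : A) (_ : B) => x) 1 :=
  ⟨Unit, inferInstance, by simp, fun _ _ => x, fun _ _ => 1, by simp⟩

theorem const_mul (h : FactorRankLE M r) (x : ℝ) : FactorRankLE (fun a b => x * M a b) r := by
  simpa using (const (A := A) (B := B) x).mul h

theorem pow (h : FactorRankLE M r) (k : ℕ) : FactorRankLE (fun a b => M a b ^ k) (r ^ k) := by
  induction k with
  | zero => simpa using const (A := A) (B := B) 1
  | succ k ih => simpa only [pow_succ] using ih.mul h

theorem sum {ι : Type*} {M : ι → A → B → ℝ} (s : Finset ι) (h : ∀ t, FactorRankLE (M t) r) :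
    FactorRankLE (fun a b => ∑ t ∈ s, M t a b) (s.card * r) := by
  classical
  induction s using Finset.induction_on with
  | empty => exact ⟨Empty, inferInstance, by simp, fun _ => Empty.elim, Empty.elim, by simp⟩
  | insert t s ht ih =>
    simp only [Finset.sum_insert ht, Finset.card_insert_of_notMem ht]
    exact ((h t).add ih).mono (by rw [add_mul, one_mul, add_comm])

/-- There are at most |T| distinct rows; the left factor is the indicator of the class of the row.
-/
theorem of_comp_left {T : Type} [Fintype T] (α : A → T) (φ : T → B → ℝ) :
    FactorRankLE (fun a b => φ (α a) b) (Fintype.card T) := by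
  classical
  exact ⟨T, inferInstance, le_rfl, fun a t => if α a = t then 1 else 0, φ, by simp⟩

/-- Follows the recurrence T_{d+2} = 2x·T_{d+1} − T_d; the base r + 1 instead of r absorbs the
subtracted term. -/
theorem chebyshev (h : FactorRankLE M r) (d : ℕ) :
    FactorRankLE (fun a b => (Polynomial.Chebyshev.T ℝ d).eval (M a b)) ((r + 1) ^ d) := by
  induction d using Nat.twoStepInduction with
  | zero => simpa using const (A := A) (B := B) 1
  | one => simpa using h.mono r.le_succ
  | more d ih₀ ih₁ =>
    have key := ((h.const_mul 2).mul ih₁).add (ih₀.const_mul (-1))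
    have hfun : (fun a b => (Polynomial.Chebyshev.T ℝ ((d + 2 : ℕ) : ℤ)).eval (M a b)) =
        fun a b => 2 * M a b * (Polynomial.Chebyshev.T ℝ ((d + 1 : ℕ) : ℤ)).eval (M a b) +
          -1 * (Polynomial.Chebyshev.T ℝ (d : ℤ)).eval (M a b) := by
      funext a b
      push_cast
      rw [Polynomial.Chebyshev.T_add_two]
      simp
      ring
    rw [hfun]
    refine key.mono ?_
    have : (r + 1) ^ d ≤ (r + 1) ^ (d + 1) := Nat.pow_le_pow_right (by omega) (by omega)
    calc r * (r + 1) ^ (d + 1) + (r + 1) ^ d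
        ≤ r * (r + 1) ^ (d + 1) + (r + 1) ^ (d + 1) := by omega
      _ = (r + 1) ^ (d + 2) := by ring

end FactorRankLE

/-! ### Approximating a conjunction -/

/-- At 1 + δ the recurrence reads T_{d+2} − T_{d+1} = (T_{d+1} − T_d) + 2δ·T_{d+1}. As T_{d+1} ≥ 1,
each increment exceeds the previous one by at least 2δ, and the odd multiples of δ sum to d²δ. -/
theorem chebyshev_growth {δ : ℝ} (hδ : 0 ≤ δ) (d : ℕ) :
    1 + (d : ℝ) ^ 2 * δ ≤ (Polynomial.Chebyshev.T ℝ d).eval (1 + δ) := by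
  suffices h : 1 + (d : ℝ) ^ 2 * δ ≤ (Polynomial.Chebyshev.T ℝ d).eval (1 + δ) ∧
      (2 * d + 1) * δ ≤ (Polynomial.Chebyshev.T ℝ ((d + 1 : ℕ) : ℤ)).eval (1 + δ) -
        (Polynomial.Chebyshev.T ℝ d).eval (1 + δ) from h.1
  induction d with
  | zero => simp
  | succ d ih =>
    obtain ⟨h₀, h₁⟩ := ih
    have hrec : (Polynomial.Chebyshev.T ℝ ((d + 1 + 1 : ℕ) : ℤ)).eval (1 + δ) =
        2 * (1 + δ) * (Polynomial.Chebyshev.T ℝ ((d + 1 : ℕ) : ℤ)).eval (1 + δ) -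
          (Polynomial.Chebyshev.T ℝ (d : ℤ)).eval (1 + δ) := by
      push_cast
      rw [add_assoc, one_add_one_eq_two, Polynomial.Chebyshev.T_add_two]
      simp
    have hcast : ((d + 1 : ℕ) : ℝ) = d + 1 := by push_cast; rfl
    have hlow : 1 + ((d + 1 : ℕ) : ℝ) ^ 2 * δ ≤
        (Polynomial.Chebyshev.T ℝ ((d + 1 : ℕ) : ℤ)).eval (1 + δ) := by
      rw [hcast]
      linarith
    refine ⟨hlow, ?_⟩
    have h1 : 1 ≤ (Polynomial.Chebyshev.T ℝ ((d + 1 : ℕ) : ℤ)).eval (1 + δ) := by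
      have : 0 ≤ ((d + 1 : ℕ) : ℝ) ^ 2 * δ := by positivity
      linarith
    have := mul_le_mul_of_nonneg_left h1 hδ
    rw [hrec, hcast]
    linarith

/-- A conjunction of `N` predicates, each of which depends on at most `q` different classes of
rows, is approximated to within `2⁻ᵏ` by a matrix whose logarithmic rank is about `k √N`. -/
theorem exists_factorRankLE_approx_forall {A B ι : Type*} [Fintype ι] [Nonempty ι] {q : ℕ}
    (P : ι → A → B → Bool)
    (hP : ∀ t, FactorRankLE (fun a b => if P t a b then (0 : ℝ) else 1) q) {d : ℕ}
    (hd : Fintype.card ι ≤ d ^ 2) (k : ℕ) :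
    ∃ M : A → B → ℝ, FactorRankLE M (((Fintype.card ι * q + 2) ^ d) ^ k) ∧
      ∀ a b, ((∀ t, P t a b = true) → M a b = 1) ∧
        ((¬∀ t, P t a b = true) → |M a b| ≤ (1 / 2) ^ k) := by
  classical
  set N : ℝ := ((Fintype.card ι : ℕ) : ℝ) with hN
  have hNpos : 0 < N := Nat.cast_pos.mpr Fintype.card_pos
  let W : A → B → ℝ := fun a b => ∑ t, if P t a b then (0 : ℝ) else 1
  let T : ℝ → ℝ := fun x => (Polynomial.Chebyshev.T ℝ d).eval x
  -- This affine map sends W = 0 to 1 + 1/N and the range 1 ≤ W ≤ N into [-1, 1], where |T_d| ≤ 1.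
  let Z : A → B → ℝ := fun a b => (1 + 1 / N) + (-(1 / N)) * W a b
  have hT : 2 ≤ T (1 + 1 / N) := by
    have h := chebyshev_growth (δ := 1 / N) (by positivity) d
    have hd' : N ≤ (d : ℝ) ^ 2 := by
      rw [hN]
      exact_mod_cast hd
    have : 1 ≤ (d : ℝ) ^ 2 * (1 / N) := by
      rw [mul_one_div, le_div_iff₀ hNpos]
      linarith
    simp only [T]
    linarith
  refine ⟨fun a b => ((T (1 + 1 / N))⁻¹ * T (Z a b)) ^ k, ?_, fun a b => ⟨fun h => ?_, fun h => ?_⟩⟩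
  · have hW : FactorRankLE W (Fintype.card ι * q) := FactorRankLE.sum Finset.univ hP
    have hZ : FactorRankLE Z (Fintype.card ι * q + 1) :=
      ((FactorRankLE.const (1 + 1 / N)).add (hW.const_mul (-(1 / N)))).mono (by omega)
    exact ((hZ.chebyshev d).const_mul _).pow k
  · have hZ : Z a b = 1 + 1 / N := by simp [Z, W, h]
    simp only [hZ]
    rw [inv_mul_cancel₀ (by linarith), one_pow]
  · push Not at h
    obtain ⟨t, ht⟩ := h
    have hW1 : 1 ≤ W a b := by
      calc (1 : ℝ) = if P t a b then (0 : ℝ) else 1 := by simp [ht]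
        _ ≤ W a b := Finset.single_le_sum (f := fun t => if P t a b then (0 : ℝ) else 1)
            (fun t _ => by split_ifs <;> norm_num) (Finset.mem_univ t)
    have hW2 : W a b ≤ N := by
      calc W a b ≤ ∑ _t : ι, (1 : ℝ) := Finset.sum_le_sum fun t _ => by split_ifs <;> norm_num
        _ = N := by simp [hN]
    have hZ : |Z a b| ≤ 1 := by
      have hZ' : Z a b = 1 + (1 - W a b) / N := by simp only [Z]; ring
      have h1 : (1 - W a b) / N ≤ 0 := div_nonpos_of_nonpos_of_nonneg (by linarith) hNpos.le
      have h2 : -1 ≤ (1 - W a b) / N := by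
        rw [le_div_iff₀ hNpos]
        linarith
      rw [hZ', abs_le]
      constructor <;> linarith
    rw [abs_pow, abs_mul, abs_inv, abs_of_pos (by linarith : 0 < T (1 + 1 / N))]
    have hT1 : |T (Z a b)| ≤ 1 := Polynomial.Chebyshev.abs_eval_T_real_le_one d hZ
    have hinv : (T (1 + 1 / N))⁻¹ ≤ 1 / 2 := by
      exact (inv_anti₀ (by norm_num) hT).trans_eq (by norm_num)
    have hinv0 : 0 ≤ (T (1 + 1 / N))⁻¹ := inv_nonneg.mpr (by linarith)
    refine pow_le_pow_left₀ (by positivity) ?_ k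
    nlinarith [abs_nonneg (T (Z a b))]

theorem arank_le {X Y : Type*} [Fintype Y] {H : X → Y → Bool} {M : X → Y → ℝ} {r : ℕ}
    (hM : FactorRankLE M r) (happrox : ∀ x y, |M x y - if H x y then 1 else 0| ≤ 1 / 3) :
    arank H ≤ r := by
  refine le_trans (Nat.sInf_le ?_) hM.rank_le
  exact ⟨Matrix.of M, fun x y => by simpa [commMatrix] using happrox x y, rfl⟩

/-- The approximate rank of an unambiguous lookup function, from approximations of its cells. -/
theorem arank_lookup_le {X Y : Type*} [Fintype Y] {F : X → Y → Bool} {c m r : ℕ}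
    {G : CellFamily X Y c m} (hG : IsUnambiguous F G)
    (h : ∀ i, ∃ M : (Fin c → X) × (BitString c → BitString m) →
        (Fin c → Y) × (BitString c → BitString m) → ℝ, FactorRankLE M r ∧
        ∀ p q, |M p q - if G i p.1 (p.2 i) q.1 (q.2 i) then 1 else 0| ≤ (1 / 2) ^ (c + 2)) :
    arank (lookup F G) ≤ 2 ^ c * r := by
  choose M hM happrox using h
  have hsum := FactorRankLE.sum (Finset.univ : Finset (BitString c)) hM
  rw [Finset.card_univ, Fintype.card_fun, Fintype.card_bool, Fintype.card_fin] at hsum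
  refine arank_le hsum fun p q => ?_
  -- By unambiguity every cell other than the addressed one contributes 0.
  have hlookup : (if lookup F G p q then (1 : ℝ) else 0) =
      ∑ i, if G i p.1 (p.2 i) q.1 (q.2 i) then (1 : ℝ) else 0 := by
    rw [Finset.sum_eq_single (powFun F p.1 q.1)]
    · rfl
    · intro i _ hi
      rw [if_neg fun h => hi (hG i _ _ _ _ h).symm]
    · simp
  rw [hlookup, ← Finset.sum_sub_distrib]
  calc _ ≤ ∑ i, |M i p q - if G i p.1 (p.2 i) q.1 (q.2 i) then 1 else 0| :=
        Finset.abs_sum_le_sum_abs _ _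
    _ ≤ ∑ _i : BitString c, (1 / 2 : ℝ) ^ (c + 2) := Finset.sum_le_sum fun i _ => happrox i p q
    _ = 1 / 4 := by
        rw [Finset.sum_const, Finset.card_univ, Fintype.card_fun, Fintype.card_bool,
          Fintype.card_fin, nsmul_eq_mul, pow_add, ← mul_assoc]
        push_cast
        rw [← mul_pow]
        norm_num
    _ ≤ 1 / 3 := by norm_num

/-! ### Certificates -/

/-- An input bit belongs to one player and a gate value is XOR-shared, so zeroing the other player's
input splits any wire into two local shares. -/
theorem Wire.value_xor {n k t : ℕ} (w : Wire n k t) (x : BitString n) (y : BitString k)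
    (a b : Fin t → Bool) :
    w.value x y (fun h => xor (a h) (b h)) =
      xor (w.value x (fun _ => false) a) (w.value (fun _ => false) y b) := by
  cases w <;> simp [Wire.value]

namespace Circuit

variable {n k : ℕ} {C : Circuit n k} {c : ℕ} {x : Fin c → BitString n} {y : Fin c → BitString k}
  {i : BitString c} {w : Transcript c C.size}

/-- Strong induction along the topological order: the local checks force every claimed output. -/
theorem IsCertificate.output_eq (h : C.IsCertificate x y i w) (j : Fin c) :
    ∀ g, w (j, g, 2) = C.gateValue (x j) (y j) g := by
  rintro ⟨g, hg⟩
  induction g using Nat.strong_induction_on with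
  | _ g ih =>
    rw [h.gate_output, h.left_input, h.right_input, Circuit.gateValue]
    congr 2 <;> exact funext fun l => ih l l.isLt _

theorem IsCertificate.powFun_eq (h : C.IsCertificate x y i w)
    {F : BitString n → BitString k → Bool} (hC : C.Computes F) : powFun F x y = i := by
  funext j
  rw [← h.final_output j, powFun, ← hC, Circuit.eval]
  congr 1
  exact funext fun g => (h.output_eq j g).symm

theorem exists_isCertificate {F : BitString n → BitString k → Bool} (hC : C.Computes F)
    (x : Fin c → BitString n) (y : Fin c → BitString k) :
    ∃ w, C.IsCertificate x y (powFun F x y) w := by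
  refine ⟨fun p => ![(C.left p.2.1).value (x p.1) (y p.1) fun h =>
      C.gateValue (x p.1) (y p.1) ⟨h.val, h.isLt.trans p.2.1.isLt⟩,
    (C.right p.2.1).value (x p.1) (y p.1) fun h =>
      C.gateValue (x p.1) (y p.1) ⟨h.val, h.isLt.trans p.2.1.isLt⟩,
    C.gateValue (x p.1) (y p.1) p.2.1] p.2.2, ?_, ?_, ?_, ?_⟩
  · intro j g; simp
  · intro j g; simp
  · intro j g
    simp only [Matrix.cons_val]
    rw [Circuit.gateValue]
  · intro j
    simpa [powFun, Circuit.eval] using hC (x j) (y j)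

/-- The individual local conditions in the definition of a certificate. -/
def check (C : Circuit n k) (x : Fin c → BitString n) (y : Fin c → BitString k) (i : BitString c)
    (w : Transcript c C.size) : (Fin c × Fin C.size × Fin 3) ⊕ Fin c → Bool
  | .inl (j, g, 0) => w (j, g, 0) ==
      (C.left g).value (x j) (y j) fun h => w (j, ⟨h.val, h.isLt.trans g.isLt⟩, 2)
  | .inl (j, g, 1) => w (j, g, 1) ==
      (C.right g).value (x j) (y j) fun h => w (j, ⟨h.val, h.isLt.trans g.isLt⟩, 2)
  | .inl (j, g, 2) => w (j, g, 2) == C.op g (w (j, g, 0)) (w (j, g, 1))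
  | .inr j => C.out.value (x j) (y j) (fun h => w (j, h, 2)) == i j

theorem isCertificate_iff_check :
    C.IsCertificate x y i w ↔ ∀ t, C.check x y i w t = true := by
  constructor
  · rintro ⟨h₀, h₁, h₂, h₃⟩ (⟨j, g, s⟩ | j)
    · fin_cases s
      · simpa [check] using h₀ j g
      · simpa [check] using h₁ j g
      · simpa [check] using h₂ j g
    · simpa [check] using h₃ j
  · intro h
    exact ⟨fun j g => by simpa [check] using h (.inl (j, g, 0)),
      fun j g => by simpa [check] using h (.inl (j, g, 1)),
      fun j g => by simpa [check] using h (.inl (j, g, 2)),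
      fun j => by simpa [check] using h (.inr j)⟩

/-- Each local condition on `u ⊕ v` involves at most three bits of Alice. -/
theorem exists_check_factor (C : Circuit n k) (i : BitString c)
    (t : (Fin c × Fin C.size × Fin 3) ⊕ Fin c) :
    ∃ (α : (Fin c → BitString n) → Transcript c C.size → Bool × Bool × Bool)
      (φ : Bool × Bool × Bool → (Fin c → BitString k) → Transcript c C.size → Bool),
      ∀ x y u v, C.check x y i (fun p => xor (u p) (v p)) t = φ (α x u) y v := by
  rcases t with ⟨j, g, s⟩ | j
  · fin_cases s
    -- Unused coordinates are padded with `false` so that all checks share one 8-element type of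
    -- messages.
    · refine ⟨fun x u => (u (j, g, 0), (C.left g).value (x j) (fun _ => false) fun h =>
          u (j, ⟨h.val, h.isLt.trans g.isLt⟩, 2), false),
        fun b y v => xor b.1 (v (j, g, 0)) == xor b.2.1 ((C.left g).value (fun _ => false) (y j)
          fun h => v (j, ⟨h.val, h.isLt.trans g.isLt⟩, 2)), fun x y u v => ?_⟩
      simp [check, Wire.value_xor]
    · refine ⟨fun x u => (u (j, g, 1), (C.right g).value (x j) (fun _ => false) fun h =>
          u (j, ⟨h.val, h.isLt.trans g.isLt⟩, 2), false),
        fun b y v => xor b.1 (v (j, g, 1)) == xor b.2.1 ((C.right g).value (fun _ => false) (y j)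
          fun h => v (j, ⟨h.val, h.isLt.trans g.isLt⟩, 2)), fun x y u v => ?_⟩
      simp [check, Wire.value_xor]
    · exact ⟨fun x u => (u (j, g, 0), u (j, g, 1), u (j, g, 2)),
        fun b y v => xor b.2.2 (v (j, g, 2)) ==
          C.op g (xor b.1 (v (j, g, 0))) (xor b.2.1 (v (j, g, 1))), fun x y u v => rfl⟩
  · refine ⟨fun x u => (C.out.value (x j) (fun _ => false) fun h => u (j, h, 2), false, false),
      fun b y v => xor b.1 (C.out.value (fun _ => false) (y j) fun h => v (j, h, 2)) == i j,
      fun x y u v => ?_⟩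
    simp [check, Wire.value_xor]

open Classical in
/-- The family of cells that check transcripts of `C` laid out by `e`. -/
noncomputable def certificateFamily {m : ℕ} (C : Circuit n k)
    (e : Fin c × Fin C.size × Fin 3 ≃ Fin m) : CellFamily (BitString n) (BitString k) c m :=
  fun i x u y v => decide (C.IsCertificate x y i fun p => bitXor u v (e p))

variable {m : ℕ} {e : Fin c × Fin C.size × Fin 3 ≃ Fin m}

theorem certificateFamily_eq_true {u v : BitString m} :
    C.certificateFamily e i x u y v = true ↔
      C.IsCertificate x y i fun p => bitXor u v (e p) := by
  simp [certificateFamily]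

theorem isUnambiguous_certificateFamily {F : BitString n → BitString k → Bool}
    (hC : C.Computes F) : IsUnambiguous F (C.certificateFamily e) :=
  fun _ _ _ _ _ h => (certificateFamily_eq_true.mp h).powFun_eq hC

theorem isNontrivialXORFamily_certificateFamily {F : BitString n → BitString k → Bool}
    (hC : C.Computes F) (hsize : 0 < C.size) (hc : 0 < c) :
    IsNontrivialXORFamily F (C.certificateFamily e) where
  nontrivial x y := by
    obtain ⟨w, hw⟩ := exists_isCertificate hC x y
    -- The honest transcript against its complement: the output of gate 0 in instance 0 is forced,
    -- so both cannot be certificates.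
    refine ⟨fun l => w (e.symm l), fun _ => false, fun l => !w (e.symm l), fun _ => false, ?_⟩
    intro heq
    have h₁ : C.certificateFamily e (powFun F x y) x (fun l => w (e.symm l)) y
        (fun _ => false) = true := by
      rw [certificateFamily_eq_true]
      simpa [bitXor] using hw
    have h₂ := certificateFamily_eq_true.mp (heq ▸ h₁)
    have := (h₂.output_eq ⟨0, hc⟩ ⟨0, hsize⟩).trans (hw.output_eq ⟨0, hc⟩ ⟨0, hsize⟩).symm
    simp [bitXor] at this
  xor_function i u u' v v' x y h := by
    rw [Bool.eq_iff_iff, certificateFamily_eq_true, certificateFamily_eq_true, h]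

theorem arank_lookup_certificateFamily_le {F : BitString n → BitString k → Bool}
    (hC : C.Computes F) (hc : 0 < c) {d : ℕ} (hd : c * (C.size * 3) + c ≤ d ^ 2) :
    arank (lookup F (C.certificateFamily e)) ≤
      2 ^ c * (((c * (C.size * 3) + c) * 8 + 2) ^ d) ^ (c + 2) := by
  refine arank_lookup_le (isUnambiguous_certificateFamily hC) fun i => ?_
  have : Nonempty (Fin c) := ⟨⟨0, hc⟩⟩
  have hcard : Fintype.card ((Fin c × Fin C.size × Fin 3) ⊕ Fin c) = c * (C.size * 3) + c := by
    simp
  let P : (Fin c × Fin C.size × Fin 3) ⊕ Fin c →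
      (Fin c → BitString n) × (BitString c → BitString m) →
      (Fin c → BitString k) × (BitString c → BitString m) → Bool := fun t p q =>
    C.check p.1 q.1 i (fun s => xor (p.2 i (e s)) (q.2 i (e s))) t
  have hP : ∀ t, FactorRankLE (fun p q => if P t p q then (0 : ℝ) else 1) 8 := by
    intro t
    obtain ⟨α, φ, hφ⟩ := C.exists_check_factor i t
    simp only [P, hφ _ _ (fun s => _) (fun s => _)]
    exact FactorRankLE.of_comp_left (T := Bool × Bool × Bool)
      (fun p : (Fin c → BitString n) × (BitString c → BitString m) => α p.1 fun s => p.2 i (e s))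
      (fun b (q : (Fin c → BitString k) × (BitString c → BitString m)) =>
        if φ b q.1 (fun s => q.2 i (e s)) then (0 : ℝ) else 1)
  obtain ⟨M, hM, hMP⟩ := exists_factorRankLE_approx_forall P hP (hcard.trans_le hd) (c + 2)
  rw [hcard] at hM
  refine ⟨M, hM, fun p q => ?_⟩
  have hiff : C.certificateFamily e i p.1 (p.2 i) q.1 (q.2 i) = true ↔ ∀ t, P t p q = true :=
    certificateFamily_eq_true.trans isCertificate_iff_check
  by_cases h : ∀ t, P t p q = true
  · rw [if_pos (hiff.mpr h), (hMP p q).1 h]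
    simp
  · rw [if_neg (mt hiff.mp h), sub_zero]
    exact (hMP p q).2 h

end Circuit

/-! ### The main theorem -/

/-- Since `sInf ∅ = 0`, a positive size already implies that some circuit computes F. -/
theorem exists_circuit_of_circuitSize_pos {n k : ℕ} {F : BitString n → BitString k → Bool}
    (h : 0 < circuitSize F) : ∃ C : Circuit n k, C.Computes F ∧ C.size = circuitSize F :=
  Nat.sInf_mem (Nat.nonempty_of_pos_sInf h)

/-- With σ = c·√(cs): c + 2 ≤ 3c, d ≤ 3√(cs) and 8N + 2 ≤ (2+σ)^6 give 3·3·6 = 54, and the factor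
2^c adds one more σ. -/
theorem logb_rank_bound {c s : ℕ} (hc : 0 < c) (hs : 0 < s) {d : ℕ}
    (hd : d = Nat.sqrt (c * (s * 3) + c) + 1) :
    Real.logb 2 ((2 ^ c * (((c * (s * 3) + c) * 8 + 2) ^ d) ^ (c + 2) : ℕ) : ℝ) ≤
      55 * ((c : ℝ) ^ (3 / 2 : ℝ) * √(s : ℝ)) *
        Real.logb 2 (2 + (c : ℝ) ^ (3 / 2 : ℝ) * √(s : ℝ)) := by
  have hc1 : (1 : ℝ) ≤ c := by exact_mod_cast hc
  have hs1 : (1 : ℝ) ≤ s := by exact_mod_cast hs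
  set a : ℝ := √(c : ℝ) with ha
  set b : ℝ := √(s : ℝ) with hb
  have ha1 : 1 ≤ a := Real.one_le_sqrt.mpr hc1
  have hb1 : 1 ≤ b := Real.one_le_sqrt.mpr hs1
  have hac : a ^ 2 = c := Real.sq_sqrt (by linarith)
  have hbs : b ^ 2 = s := Real.sq_sqrt (by linarith)
  have hpow : (c : ℝ) ^ (3 / 2 : ℝ) = c * a := by
    rw [show (3 / 2 : ℝ) = 1 + 1 / 2 by norm_num, Real.rpow_add (by linarith), Real.rpow_one,
      ← Real.sqrt_eq_rpow]
  rw [hpow]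
  have hab : 1 ≤ a * b := one_le_mul_of_one_le_of_one_le ha1 hb1
  set σ : ℝ := c * a * b with hσ
  have hσab : σ = c * (a * b) := by rw [hσ, mul_assoc]
  have hcσ : c ≤ σ := by rw [hσab]; nlinarith
  have habσ : a * b ≤ σ := by rw [hσab]; nlinarith
  have hσ1 : 1 ≤ σ := hc1.trans hcσ
  have hcs : (c : ℝ) * s = (a * b) ^ 2 := by rw [mul_pow, hac, hbs]
  have hN : ((c * (s * 3) + c : ℕ) : ℝ) ≤ 4 * (a * b) ^ 2 := by
    push_cast
    nlinarith
  have hdle : (d : ℝ) ≤ 3 * (a * b) := by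
    have h1 : ((Nat.sqrt (c * (s * 3) + c) : ℕ) : ℝ) ≤ 2 * (a * b) := by
      refine (Real.nat_sqrt_le_real_sqrt).trans (Real.sqrt_le_iff.mpr ⟨by positivity, ?_⟩)
      linarith [mul_pow 2 (a * b) 2]
    rw [hd]
    push_cast at *
    linarith
  set L : ℝ := Real.logb 2 (2 + σ) with hL
  have hL1 : 1 ≤ L := by
    rw [hL, Real.le_logb_iff_rpow_le (by norm_num) (by linarith), Real.rpow_one]
    linarith
  have hbase : Real.logb 2 (((c * (s * 3) + c) * 8 + 2 : ℕ) : ℝ) ≤ 6 * L := by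
    have hle : (((c * (s * 3) + c) * 8 + 2 : ℕ) : ℝ) ≤ (2 + σ) ^ 6 := by
      have h1 : (a * b) ^ 2 ≤ σ ^ 2 := pow_le_pow_left₀ (by linarith) habσ 2
      have h2 : (81 : ℝ) ≤ (2 + σ) ^ 4 :=
        le_trans (by norm_num) (pow_le_pow_left₀ (by norm_num) (by linarith : 3 ≤ 2 + σ) 4)
      have h3 : (((c * (s * 3) + c) * 8 + 2 : ℕ) : ℝ) ≤ 34 * σ ^ 2 := by
        rw [Nat.cast_add, Nat.cast_mul]
        push_cast at *
        nlinarith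
      calc (((c * (s * 3) + c) * 8 + 2 : ℕ) : ℝ) ≤ 34 * σ ^ 2 := h3
        _ ≤ 81 * (2 + σ) ^ 2 := by nlinarith
        _ ≤ (2 + σ) ^ 4 * (2 + σ) ^ 2 := mul_le_mul_of_nonneg_right h2 (by positivity)
        _ = (2 + σ) ^ 6 := by ring
    calc _ ≤ Real.logb 2 ((2 + σ) ^ 6) :=
          Real.logb_le_logb_of_le (by norm_num) (by positivity) hle
      _ = 6 * L := by rw [Real.logb_pow]; norm_num [hL]
  have hlog : Real.logb 2 ((2 ^ c * (((c * (s * 3) + c) * 8 + 2) ^ d) ^ (c + 2) : ℕ) : ℝ) =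
      c + (c + 2) * (d * Real.logb 2 (((c * (s * 3) + c) * 8 + 2 : ℕ) : ℝ)) := by
    rw [Nat.cast_mul, Nat.cast_pow, Nat.cast_pow, Nat.cast_pow,
      Real.logb_mul (by positivity) (by positivity), Real.logb_pow, Real.logb_pow, Real.logb_pow]
    norm_num
  rw [hlog]
  have hdL : (d : ℝ) * Real.logb 2 (((c * (s * 3) + c) * 8 + 2 : ℕ) : ℝ) ≤
      3 * (a * b) * (6 * L) :=
    (mul_le_mul_of_nonneg_left hbase (by positivity)).trans
      (mul_le_mul_of_nonneg_right hdle (by linarith))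
  have hσL : σ ≤ σ * L := le_mul_of_one_le_right (by linarith) hL1
  calc (c : ℝ) + (c + 2) * (d * Real.logb 2 (((c * (s * 3) + c) * 8 + 2 : ℕ) : ℝ))
      ≤ σ + (3 * c) * (3 * (a * b) * (6 * L)) := by
        refine add_le_add hcσ ((mul_le_mul_of_nonneg_left hdL (by linarith)).trans
          (mul_le_mul_of_nonneg_right (by linarith) ?_))
        have : 0 ≤ a * b := by linarith
        have : 0 ≤ L := by linarith
        positivity
    _ = σ + 54 * (σ * L) := by rw [hσab]; ring
    _ ≤ 55 * σ * L := by linarith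

theorem mainTheorem4 :
    ∃ (K : ℝ) (d : ℕ), ∀ (n k : ℕ) (F : BitString n → BitString k → Bool),
      0 < circuitSize F → ∀ c : ℕ, 0 < c →
        ∃ (m : ℕ) (G : CellFamily (BitString n) (BitString k) c m),
          IsNontrivialXORFamily F G ∧
          ChecksCertificates F G ∧
          IsUnambiguous F G ∧
          Real.logb 2 (arank (lookup F G)) ≤
            K * ((c : ℝ) ^ (3 / 2 : ℝ) * √(circuitSize F : ℝ)) *
              Real.logb 2 (2 + (c : ℝ) ^ (3 / 2 : ℝ) * √(circuitSize F : ℝ)) ^ d := by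
  refine ⟨55, 1, fun n k F hF c hc => ?_⟩
  obtain ⟨C, hC, hsize⟩ := exists_circuit_of_circuitSize_pos hF
  let e := Fintype.equivFin (Fin c × Fin C.size × Fin 3)
  refine ⟨_, C.certificateFamily e,
    Circuit.isNontrivialXORFamily_certificateFamily hC (hsize ▸ hF) hc,
    ⟨C, hC, hsize, e, fun i x u y v => Circuit.certificateFamily_eq_true⟩,
    Circuit.isUnambiguous_certificateFamily hC, ?_⟩
  have hbound := Circuit.arank_lookup_certificateFamily_le (e := e) hC hc
    (Nat.lt_succ_sqrt' (c * (C.size * 3) + c)).le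
  have hlog := logb_rank_bound hc (hsize ▸ hF : 0 < C.size) rfl
  rw [← hsize, pow_one]
  refine le_trans ?_ hlog
  -- Monotonicity of the logarithm needs a positive argument; for rank 0 the convention log 0 = 0
  -- applies.
  rcases Nat.eq_zero_or_pos (arank (lookup F (C.certificateFamily e))) with h0 | h0
  · rw [h0, Nat.cast_zero, Real.logb_zero]
    exact Real.logb_nonneg (by norm_num)
      (by exact_mod_cast Nat.one_le_iff_ne_zero.mpr (by positivity))
  · exact Real.logb_le_logb_of_le (by norm_num) (by exact_mod_cast h0) (by exact_mod_cast hbound)
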